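/- **Theorem 1.1 (Yau's gradient estimate).** Let $G$ be a finitely generated abelian group (written additively), so that $G\cong\mathbb{Z}^m\oplus\bigoplus_{i=1}^l\mathbb{Z}_{q_i}$ with prime powers $q_i$, and let $S$ be a finite symmetric generating set of $G$, i.e. $S=-S$; elements of $S$ may be repeated (then $S=-S$ is an equality of multisets) and $0\in S$ is allowed. In the Cayley graph $(G,S)$ write $y\sim x$ if $y-x\in S$, let $d$ be the graph (word) distance and $B_r(x)=\{y\in G: d(y,x)\le r\}$. For $f:G\to\mathbb{R}$ put $$Lf(x)=\sum_{y\sim x}(f(y)-f(x))=\sum_{s\in S}(f(x+s)-f(x)),\qquad |\nabla f|(x)=\Big(\sum_{s\in S}(f(x+s)-f(x))^2\Big)^{1/2},$$ the sums counting repeated elements of $S$ with multiplicity. Then there exist constants $C_1,C_2>0$, depending only on $m$ and $S$ (as a generating set of $G$), such that for every $x\in G$, every real $R\ge 1$ and every function $f$ that is positive on $B_{C_1R}(x)$ and harmonic there, that is, $Lf(y)=0$ for all $y\in B_{C_1R}(x)$, we have $$|\nabla f|(x)\le\frac{C_2}{R}\,f(x).$$ -/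

import Mathlib

namespace AbelianCayley

/-- The word metric of the Cayley graph of `G` with respect to the finite multiset `S`: the length
of a shortest path `x = p 0 ∼ p 1 ∼ ⋯ ∼ p k = y`, where `u ∼ v` means `v - u ∈ S`. When `S`
generates `G` and is symmetric, such paths exist between any two vertices. -/
noncomputable def wordDist {G : Type*} [AddCommGroup G] (S : Multiset G) (x y : G) : ℕ :=
  sInf {k : ℕ | ∃ p : ℕ → G, p 0 = x ∧ p k = y ∧ ∀ i < k, p (i + 1) - p i ∈ S}

/-- The closed geodesic ball with center `x` and real radius `r`. -/
def ball {G : Type*} [AddCommGroup G] (S : Multiset G) (x : G) (r : ℝ) : Set G :=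
  {y : G | (wordDist S y x : ℝ) ≤ r}

/-- The discrete Laplacian `∑_{y ∼ x} (f y - f x)`. The neighbors of `x` are the `x + s`, `s ∈ S`;
repeated elements of `S` are multiple edges and are counted with multiplicity. -/
def laplacian {G : Type*} [AddCommGroup G] (S : Multiset G) (f : G → ℝ) (x : G) : ℝ :=
  (S.map fun s => f (x + s) - f x).sum

/-- `f` is discrete harmonic on `Ω`. Only values of `f` on `Ω` and on neighbors of points of `Ω`
matter. -/
def HarmonicOn {G : Type*} [AddCommGroup G] (S : Multiset G) (f : G → ℝ) (Ω : Set G) : Prop :=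
  ∀ y ∈ Ω, laplacian S f y = 0

/-- The length of the gradient, `√(∑_{y ∼ x} (f y - f x)²)`, with multiplicity. -/
noncomputable def gradNorm {G : Type*} [AddCommGroup G] (S : Multiset G) (f : G → ℝ) (x : G) : ℝ :=
  Real.sqrt (S.map fun s => (f (x + s) - f x) ^ 2).sum

end AbelianCayley

/-! Put `u = √f`, `D = |S|` and `E(x) = ∑ (u(x+s) - u(x))²`. Since translations commute, harmonicity
of `u²` turns `LE` into a weighted sum of squares (`bochner_identity`). The squares in which the
second step undoes the first already give `E² ≤ 4 D² u² LE` (`bochner_inequality`), so `E/u²` cannot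
be large far inside a domain.

To localize, look at a maximum of `h² E / u²` with `h(y) = 1 - ‖π(y-x)‖²/R²`, where `π` is the
projection to the free coordinates. One step changes `h` by `O(1/R)`; as `S = -S`, the linear terms
cancel and `Lh = O(1/R²)`. This gives `E(x) ≤ B f(x)/R²` (`cutoff_energy_le_of_max`,
`energy_sqrt_le`). The region `h > 0` lies in a word ball of radius `O(R)` by
`exists_hom_wordLength_le`, and factoring differences of squares passes from `√f` back to `f`. -/

namespace AbelianCayley

/-! ### Bochner formula for the square root of a harmonic function. -/

theorem sum_sq_sub {ι : Type*} [Fintype ι] (α : ι → ℝ) (a : ℝ)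
    (h : ∑ i, α i ^ 2 = Fintype.card ι * a ^ 2) :
    ∑ i, (α i - a) ^ 2 = 2 * Fintype.card ι * a ^ 2 - 2 * a * ∑ i, α i := by
  have : ∀ i, (α i - a) ^ 2 = α i ^ 2 - 2 * a * α i + a ^ 2 := fun i => by ring
  simp only [this, Finset.sum_add_distrib, Finset.sum_sub_distrib, ← Finset.mul_sum, h,
    Finset.sum_const, Finset.card_univ, nsmul_eq_mul]
  ring

/-- The Bochner identity for the square root of a positive harmonic function on an abelian Cayley
graph, in terms of its values `a` at a vertex, `α i` at the neighbors and `β i j` at the second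
neighbors. -/
theorem bochner_identity {ι : Type*} [Fintype ι] {a : ℝ} (ha : 0 < a) {α : ι → ℝ}
    (hα : ∀ i, 0 < α i) {β : ι → ι → ℝ} (hβ : ∀ i j, β i j = β j i)
    (h₁ : ∑ i, α i ^ 2 = Fintype.card ι * a ^ 2)
    (h₂ : ∀ i, ∑ j, β i j ^ 2 = Fintype.card ι * α i ^ 2) :
    ∑ i, (∑ j, (β i j - α i) ^ 2 - ∑ j, (α j - a) ^ 2) =
      ∑ i, ∑ j, a / α i * (β i j - α j * α i / a) ^ 2 := by
  have hr : ∀ i, ∑ j, a / α i * (β i j - α j * α i / a) ^ 2 =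
      2 * Fintype.card ι * a * α i - 2 * ∑ j, β i j * α j := by
    intro i
    have hi := (hα i).ne'
    have : ∀ j, a / α i * (β i j - α j * α i / a) ^ 2 =
        a / α i * β i j ^ 2 - 2 * (β i j * α j) + α i / a * α j ^ 2 := fun j => by
      field_simp
      ring
    simp only [this, Finset.sum_add_distrib, Finset.sum_sub_distrib, ← Finset.mul_sum, h₁, h₂]
    field_simp
    ring
  have hl : ∀ i, ∑ j, (β i j - α i) ^ 2 - ∑ j, (α j - a) ^ 2 =
      2 * Fintype.card ι * α i ^ 2 - 2 * ∑ j, β i j * α i -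
        (2 * Fintype.card ι * a ^ 2 - 2 * a * ∑ j, α j) := by
    intro i
    rw [sum_sq_sub α a h₁, sum_sq_sub (β i) (α i) (h₂ i), ← Finset.sum_mul]
    ring
  -- Commutativity of the group enters the identity only here.
  have hs : ∑ i, ∑ j, β i j * α i = ∑ i, ∑ j, β i j * α j := by
    rw [Finset.sum_comm]
    exact Finset.sum_congr rfl fun i _ => Finset.sum_congr rfl fun j _ => by rw [hβ]
  simp only [hr, hl, Finset.sum_sub_distrib, ← Finset.mul_sum, hs, h₁, Finset.sum_const,
    Finset.card_univ, nsmul_eq_mul]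
  ring

/-- The defect of the mean of `p, q` below `a` is controlled by that of `p q / a`. -/
theorem sub_mean_le_abs {a p q : ℝ} (ha : 0 < a) (hp : 0 < p) (hq : 0 < q) :
    a - (p + q) / 2 ≤ |a - q * p / a| := by
  rcases le_total a ((p + q) / 2) with h | h
  · exact (sub_nonpos.2 h).trans (abs_nonneg _)
  · refine le_trans ?_ (le_abs_self _)
    have : q * p / a ≤ (p + q) / 2 := by
      rw [div_le_iff₀ ha]
      nlinarith [sq_nonneg (p - q)]
    linarith

/-- Only the terms `j = ν i` of the Bochner sum are kept, where `β i j = a`. The map `ν` need not be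
a permutation; `hαν` is all that is used of the symmetry of sums. -/
theorem bochner_inequality {ι : Type*} [Fintype ι] [Nonempty ι] {a : ℝ} (ha : 0 < a) {α : ι → ℝ}
    (hα : ∀ i, 0 < α i) {β : ι → ι → ℝ} (hβ : ∀ i j, β i j = β j i)
    (h₁ : ∑ i, α i ^ 2 = Fintype.card ι * a ^ 2)
    (h₂ : ∀ i, ∑ j, β i j ^ 2 = Fintype.card ι * α i ^ 2)
    (ν : ι → ι) (hν : ∀ i, β i (ν i) = a) (hαν : ∑ i, α (ν i) = ∑ i, α i) :
    (∑ i, (α i - a) ^ 2) ^ 2 ≤ 4 * (Fintype.card ι : ℝ) ^ 2 * a ^ 2 *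
      ∑ i, (∑ j, (β i j - α i) ^ 2 - ∑ j, (α j - a) ^ 2) := by
  have hD : (1 : ℝ) ≤ Fintype.card ι := by exact_mod_cast Fintype.card_pos (α := ι)
  rw [bochner_identity ha hα hβ h₁ h₂]
  set D : ℝ := (Fintype.card ι : ℝ) with hDdef
  -- This bounds the Bochner weights `a / α i` below by `1 / D`.
  have hle : ∀ i, α i ≤ D * a := by
    intro i
    have : α i ^ 2 ≤ D * a ^ 2 :=
      h₁ ▸ Finset.single_le_sum (f := fun i => α i ^ 2) (fun j _ => sq_nonneg _)
        (Finset.mem_univ i)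
    refine le_of_sq_le_sq ?_ (by positivity)
    nlinarith [sq_nonneg a]
  have hE : ∑ i, (α i - a) ^ 2 = 2 * a * ∑ i, (a - (α i + α (ν i)) / 2) := by
    rw [sum_sq_sub α a h₁, Finset.sum_sub_distrib, ← Finset.sum_div, Finset.sum_add_distrib, hαν]
    simp only [Finset.sum_const, Finset.card_univ, nsmul_eq_mul]
    ring
  have hE0 : 0 ≤ ∑ i, (α i - a) ^ 2 := Finset.sum_nonneg fun i _ => sq_nonneg _
  have hE1 : ∑ i, (α i - a) ^ 2 ≤ 2 * a * ∑ i, |a - α (ν i) * α i / a| := by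
    rw [hE]
    gcongr with i
    exact sub_mean_le_abs ha (hα _) (hα _)
  calc (∑ i, (α i - a) ^ 2) ^ 2 ≤ (2 * a * ∑ i, |a - α (ν i) * α i / a|) ^ 2 := by gcongr
    _ = 4 * a ^ 2 * (∑ i, |a - α (ν i) * α i / a|) ^ 2 := by ring
    _ ≤ 4 * a ^ 2 * (D * ∑ i, |a - α (ν i) * α i / a| ^ 2) := by
        gcongr
        exact sq_sum_le_card_mul_sum_sq
    _ = 4 * D * a ^ 2 * ∑ i, (a - α (ν i) * α i / a) ^ 2 := by
        simp only [sq_abs]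
        ring
    _ ≤ 4 * D * a ^ 2 * ∑ i, D * ∑ j, a / α i * (β i j - α j * α i / a) ^ 2 := by
        gcongr with i
        have h3 : a / α i * (a - α (ν i) * α i / a) ^ 2 ≤
            ∑ j, a / α i * (β i j - α j * α i / a) ^ 2 := by
          conv_lhs => rw [← hν i]
          have := hα i
          rw [hν i]
          simpa only [hν i] using Finset.single_le_sum
            (f := fun j => a / α i * (β i j - α j * α i / a) ^ 2)
            (fun j _ => by positivity) (Finset.mem_univ (ν i))
        have h4 : 1 ≤ D * (a / α i) := by
          rw [← mul_div_assoc, one_le_div (hα i)]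
          exact hle i
        calc (a - α (ν i) * α i / a) ^ 2 ≤ D * (a / α i) * (a - α (ν i) * α i / a) ^ 2 :=
              le_mul_of_one_le_left (sq_nonneg _) h4
          _ = D * (a / α i * (a - α (ν i) * α i / a) ^ 2) := by ring
          _ ≤ _ := by gcongr
    _ = _ := by
        rw [← Finset.mul_sum]
        ring

/-! ### Word length and its comparison with a Euclidean norm. -/

open Pointwise in
/-- The least number of elements of `S` with sum `g`. -/
noncomputable def wordLength {G : Type*} [AddCommGroup G] (S : Multiset G) (g : G) : ℕ :=
  sInf {k : ℕ | g ∈ k • {s : G | s ∈ S}}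

section WordLength

open Pointwise

variable {G : Type*} [AddCommGroup G] {S : Multiset G}

theorem neg_mem_of_symm (hsymm : S.map (fun s => -s) = S) {s : G} (hs : s ∈ S) : -s ∈ S := by
  rw [← hsymm]
  exact Multiset.mem_map_of_mem _ hs

theorem neg_mem_nsmul (hsymm : S.map (fun s => -s) = S) (k : ℕ) {g : G}
    (hg : g ∈ k • {s : G | s ∈ S}) : -g ∈ k • {s : G | s ∈ S} := by
  induction k generalizing g with
  | zero => simpa using hg
  | succ k ih =>
    rw [succ_nsmul, Set.mem_add] at hg ⊢
    obtain ⟨a, ha, b, hb, rfl⟩ := hg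
    exact ⟨-a, ih ha, -b, neg_mem_of_symm hsymm hb, (neg_add a b).symm⟩

theorem exists_mem_nsmul (hsymm : S.map (fun s => -s) = S)
    (hgen : AddSubgroup.closure {s : G | s ∈ S} = ⊤) (g : G) :
    ∃ k : ℕ, g ∈ k • {s : G | s ∈ S} := by
  have hg : g ∈ AddSubgroup.closure {s : G | s ∈ S} := hgen ▸ AddSubgroup.mem_top g
  induction hg using AddSubgroup.closure_induction with
  | mem x hx => exact ⟨1, by simpa using hx⟩
  | zero => exact ⟨0, by simp⟩
  | add x y _ _ hx hy =>
    obtain ⟨j, hj⟩ := hx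
    obtain ⟨k, hk⟩ := hy
    exact ⟨j + k, add_nsmul {s : G | s ∈ S} j k ▸ Set.add_mem_add hj hk⟩
  | neg x _ hx =>
    obtain ⟨k, hk⟩ := hx
    exact ⟨k, neg_mem_nsmul hsymm k hk⟩

theorem mem_wordLength_nsmul (hsymm : S.map (fun s => -s) = S)
    (hgen : AddSubgroup.closure {s : G | s ∈ S} = ⊤) (g : G) :
    g ∈ wordLength S g • {s : G | s ∈ S} :=
  Nat.sInf_mem (s := {k : ℕ | g ∈ k • {s : G | s ∈ S}}) (exists_mem_nsmul hsymm hgen g)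

theorem wordLength_zero : wordLength S (0 : G) = 0 :=
  Nat.eq_zero_of_le_zero (Nat.sInf_le (by simp))

theorem wordLength_le_one {s : G} (hs : s ∈ S) : wordLength S s ≤ 1 :=
  Nat.sInf_le (by simpa using hs)

theorem wordLength_add_le (hsymm : S.map (fun s => -s) = S)
    (hgen : AddSubgroup.closure {s : G | s ∈ S} = ⊤) (g h : G) :
    wordLength S (g + h) ≤ wordLength S g + wordLength S h := by
  refine Nat.sInf_le ?_
  rw [Set.mem_ofPred_eq, add_nsmul]
  exact Set.add_mem_add (mem_wordLength_nsmul hsymm hgen g) (mem_wordLength_nsmul hsymm hgen h)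

theorem wordLength_neg_le (hsymm : S.map (fun s => -s) = S)
    (hgen : AddSubgroup.closure {s : G | s ∈ S} = ⊤) (g : G) :
    wordLength S (-g) ≤ wordLength S g :=
  Nat.sInf_le (neg_mem_nsmul hsymm _ (mem_wordLength_nsmul hsymm hgen g))

theorem wordLength_nsmul_le (hsymm : S.map (fun s => -s) = S)
    (hgen : AddSubgroup.closure {s : G | s ∈ S} = ⊤) (n : ℕ) (g : G) :
    wordLength S (n • g) ≤ n * wordLength S g := by
  induction n with
  | zero => simp [wordLength_zero]
  | succ n ih =>
    rw [succ_nsmul, add_mul, one_mul]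
    exact (wordLength_add_le hsymm hgen _ _).trans (by gcongr)

theorem wordLength_zsmul_le (hsymm : S.map (fun s => -s) = S)
    (hgen : AddSubgroup.closure {s : G | s ∈ S} = ⊤) (n : ℤ) (g : G) :
    wordLength S (n • g) ≤ n.natAbs * wordLength S g := by
  rcases Int.natAbs_eq n with h | h
  · rw [h, natCast_zsmul, Int.natAbs_natCast]
    exact wordLength_nsmul_le hsymm hgen _ _
  · rw [h, neg_smul, natCast_zsmul, Int.natAbs_neg, Int.natAbs_natCast]
    exact (wordLength_neg_le hsymm hgen _).trans (wordLength_nsmul_le hsymm hgen _ _)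

theorem wordLength_sum_le (hsymm : S.map (fun s => -s) = S)
    (hgen : AddSubgroup.closure {s : G | s ∈ S} = ⊤) {κ : Type*} (t : Finset κ) (g : κ → G) :
    wordLength S (∑ i ∈ t, g i) ≤ ∑ i ∈ t, wordLength S (g i) :=
  Finset.le_sum_of_subadditive _ wordLength_zero.le (wordLength_add_le hsymm hgen) _ _

theorem exists_path_of_mem_nsmul (k : ℕ) {g : G} (hg : g ∈ k • {s : G | s ∈ S}) (x : G) :
    ∃ p : ℕ → G, p 0 = x ∧ p k = x + g ∧ ∀ i < k, p (i + 1) - p i ∈ S := by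
  induction k generalizing g with
  | zero => exact ⟨fun _ => x, rfl, by simpa [eq_comm] using hg, by simp⟩
  | succ k ih =>
    rw [succ_nsmul, Set.mem_add] at hg
    obtain ⟨a, ha, b, hb, rfl⟩ := hg
    obtain ⟨p, h0, hk, hp⟩ := ih ha
    refine ⟨fun i => if i ≤ k then p i else x + (a + b), by simpa using h0, by simp, ?_⟩
    intro i hi
    rcases (Nat.lt_succ_iff.1 hi).lt_or_eq with h | rfl
    · simpa [h.le, Nat.succ_le_of_lt h] using hp i h
    · have : x + (a + b) - (x + a) = b := by abel
      simpa [hk, this] using hb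

/-- This direction suffices: a small word length has to place a point inside the ball. -/
theorem wordDist_le_wordLength (hsymm : S.map (fun s => -s) = S)
    (hgen : AddSubgroup.closure {s : G | s ∈ S} = ⊤) (x y : G) :
    wordDist S y x ≤ wordLength S (y - x) := by
  refine (Nat.sInf_le ?_).trans (wordLength_neg_le hsymm hgen (y - x))
  obtain ⟨p, h0, hk, hp⟩ := exists_path_of_mem_nsmul _
    (mem_wordLength_nsmul hsymm hgen (-(y - x))) y
  exact ⟨p, h0, by rw [hk]; abel, hp⟩

theorem mem_ball_of_wordLength_le (hsymm : S.map (fun s => -s) = S)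
    (hgen : AddSubgroup.closure {s : G | s ∈ S} = ⊤) {x y : G} {r : ℝ}
    (h : (wordLength S (y - x) : ℝ) ≤ r) : y ∈ ball S x r :=
  le_trans (by exact_mod_cast wordDist_le_wordLength hsymm hgen x y) h

theorem finite_wordLength_le (hsymm : S.map (fun s => -s) = S)
    (hgen : AddSubgroup.closure {s : G | s ∈ S} = ⊤) (N : ℕ) :
    {g : G | wordLength S g ≤ N}.Finite := by
  classical
  refine ((Finset.range (N + 1)).biUnion fun k => k • S.toFinset).finite_toSet.subset fun g hg => ?_
  simp only [Finset.coe_biUnion, Set.mem_iUnion, Finset.mem_coe, Finset.mem_range]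
  refine ⟨wordLength S g, Nat.lt_succ_of_le hg, ?_⟩
  rw [← Finset.mem_coe, Finset.coe_nsmul]
  have h : ((S.toFinset : Finset G) : Set G) = {s : G | s ∈ S} := by ext; simp
  rw [h]
  exact mem_wordLength_nsmul hsymm hgen g

theorem fg_of_closure_multiset (hgen : AddSubgroup.closure {s : G | s ∈ S} = ⊤) :
    AddGroup.FG G := by
  classical
  refine ⟨⟨S.toFinset, ?_⟩⟩
  rw [← hgen]
  congr 1
  ext
  simp

/-- A finitely generated abelian group maps to a Euclidean space, the norm of the image controlling
the word length. -/
theorem exists_hom_wordLength_le (hsymm : S.map (fun s => -s) = S)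
    (hgen : AddSubgroup.closure {s : G | s ∈ S} = ⊤) :
    ∃ (n : ℕ) (π : G →+ EuclideanSpace ℝ (Fin n)) (C : ℝ), 0 < C ∧
      ∀ g, (wordLength S g : ℝ) ≤ C * (‖π g‖ + 1) := by
  have := fg_of_closure_multiset hgen
  obtain ⟨n, κ, _, p, hp, e, ⟨φ⟩⟩ := AddCommGroup.equiv_free_prod_directSum_zmod G
  have : ∀ i, NeZero (p i ^ e i) := fun i => ⟨pow_ne_zero _ (hp i).ne_zero⟩
  have : Finite (DirectSum κ fun i => ZMod (p i ^ e i)) :=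
    Finite.of_equiv _ DFinsupp.equivFunOnFintype.symm
  have := Fintype.ofFinite (DirectSum κ fun i => ZMod (p i ^ e i))
  let π : G →+ EuclideanSpace ℝ (Fin n) :=
    AddMonoidHom.mk' (fun g => WithLp.toLp 2 fun i => (((φ g).1 i : ℤ) : ℝ)) fun g h => by
      ext i
      simp
  let v : Fin n → G := fun i => φ.symm (Finsupp.single i 1, 0)
  let w : (DirectSum κ fun i => ZMod (p i ^ e i)) → G := fun t => φ.symm (0, t)
  have hdec : ∀ g, g = ∑ i, (φ g).1 i • v i + w (φ g).2 := by
    intro g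
    apply φ.injective
    simp only [v, w, map_add, map_sum, map_zsmul, AddEquiv.apply_symm_apply]
    ext i
    · simp [Prod.fst_sum]
    · simp [Prod.snd_sum]
  have hcoord : ∀ g i, ((((φ g).1 i).natAbs : ℕ) : ℝ) ≤ ‖π g‖ := by
    intro g i
    have := PiLp.norm_apply_le (π g) i
    rw [Nat.cast_natAbs, Int.cast_abs]
    exact this
  -- The lengths of the free basis give the linear growth; the torsion part is finite and
  -- contributes a bounded amount.
  refine ⟨n, π, ∑ i, (wordLength S (v i) : ℝ) + ∑ t, (wordLength S (w t) : ℝ) + 1,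
    by positivity, fun g => ?_⟩
  have h1 : (wordLength S g : ℝ) ≤
      ∑ i, (((φ g).1 i).natAbs : ℝ) * wordLength S (v i) + wordLength S (w (φ g).2) := by
    have : wordLength S g ≤
        ∑ i, ((φ g).1 i).natAbs * wordLength S (v i) + wordLength S (w (φ g).2) := by
      conv_lhs => rw [hdec g]
      refine (wordLength_add_le hsymm hgen _ _).trans ?_
      gcongr
      refine (wordLength_sum_le hsymm hgen _ _).trans ?_
      exact Finset.sum_le_sum fun i _ => wordLength_zsmul_le hsymm hgen _ _
    exact_mod_cast this
  have h2 : ∑ i, (((φ g).1 i).natAbs : ℝ) * wordLength S (v i) ≤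
      ‖π g‖ * ∑ i, (wordLength S (v i) : ℝ) := by
    rw [Finset.mul_sum]
    gcongr with i
    exact hcoord g i
  have h3 : (wordLength S (w (φ g).2) : ℝ) ≤ ∑ t, (wordLength S (w t) : ℝ) :=
    Finset.single_le_sum (f := fun t => (wordLength S (w t) : ℝ)) (fun _ _ => by positivity)
      (Finset.mem_univ _)
  have h4 : (0 : ℝ) ≤ ∑ i, (wordLength S (v i) : ℝ) := by positivity
  have h5 : (0 : ℝ) ≤ ∑ t, (wordLength S (w t) : ℝ) := by positivity
  nlinarith [norm_nonneg (π g), mul_nonneg (norm_nonneg (π g)) h5]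

end WordLength

/-! ### Maximum principle with a cutoff. -/

theorem cutoff_ratio_le {h δ : ℝ} (hh : 0 < h) (hδ : |δ| ≤ h / 2) :
    h ^ 4 / (h + δ) ^ 2 - h ^ 2 ≤ -2 * h * δ + 16 * δ ^ 2 := by
  obtain ⟨h1, h2⟩ := abs_le.1 hδ
  have hpos : 0 < h + δ := by linarith
  rw [sub_le_iff_le_add, div_le_iff₀ (by positivity)]
  have h3 : h ^ 2 / 4 ≤ (h + δ) ^ 2 := by nlinarith
  have h4 : 3 * h ^ 2 + 2 * h * δ ≤ 16 * (h + δ) ^ 2 := by nlinarith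
  nlinarith [mul_le_mul_of_nonneg_left h4 (sq_nonneg δ)]

theorem sq_le_of_sq_le_add {m A B : ℝ} (h : m ^ 2 ≤ A + B * m) : m ^ 2 ≤ 2 * A + B ^ 2 := by
  nlinarith [sq_nonneg (m - B)]

/-- The constant in the interior estimate, in terms of the number `D` of generators, a bound `K`
for the first and a bound `K'` for the second differences of the cutoff. -/
def interiorConst (D K K' : ℝ) : ℝ :=
  2 * (4 * D ^ 2 * (2 * K' + 16 * D * K ^ 2)) + (4 * D ^ 2 * (2 * D * (D + 1) * K)) ^ 2 +
    8 * D * K ^ 2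

/-- The estimate at a maximum point of `h² E / u²`: here `q i` is the value of `u` at a neighbor
divided by the value of `u` at the point, `E i` is the normalized energy at that neighbor, `h` and
`h + δ i` are the values of the cutoff. -/
theorem cutoff_energy_le_of_max {ι : Type*} [Fintype ι] [Nonempty ι] {q δ E : ι → ℝ}
    {h t K K' : ℝ} (hq : ∀ i, 0 < q i) (hq2 : ∑ i, q i ^ 2 = Fintype.card ι) (hh : 0 < h)
    (hh1 : h ≤ 1) (ht : 0 < t) (hK' : 0 ≤ K') (hδ : ∀ i, |δ i| ≤ K * t)
    (hδ2 : -∑ i, δ i ≤ K' * t ^ 2)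
    (hmax : ∀ i, 0 < h + δ i → (h + δ i) ^ 2 * E i ≤ h ^ 2 * (∑ j, (q j - 1) ^ 2) * q i ^ 2)
    (hE : (∑ j, (q j - 1) ^ 2) ^ 2 ≤
      4 * (Fintype.card ι : ℝ) ^ 2 * ∑ i, (E i - ∑ j, (q j - 1) ^ 2)) :
    h ^ 2 * ∑ j, (q j - 1) ^ 2 ≤ interiorConst (Fintype.card ι) K K' * t ^ 2 := by
  have hD : (1 : ℝ) ≤ Fintype.card ι := by exact_mod_cast Fintype.card_pos (α := ι)
  set D : ℝ := (Fintype.card ι : ℝ) with hDdef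
  set F : ℝ := ∑ j, (q j - 1) ^ 2 with hF
  have hF0 : 0 ≤ F := Finset.sum_nonneg fun i _ => sq_nonneg _
  have hK : 0 ≤ K := by
    obtain ⟨i⟩ := ‹Nonempty ι›
    exact nonneg_of_mul_nonneg_left ((abs_nonneg _).trans (hδ i)) ht
  have hF2 : F ≤ 2 * D := by
    have := sum_sq_sub q 1 (by simpa using hq2)
    have hs : 0 ≤ ∑ i, q i := Finset.sum_nonneg fun i _ => (hq i).le
    rw [← hF, ← hDdef] at this
    linarith
  -- Near the edge of the cutoff the crude bound `F ≤ 2 D` suffices and costs the summand `8 D K²`.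
  -- Otherwise every neighbor has positive cutoff and `hmax` applies to all of them.
  rcases le_or_gt h (2 * K * t) with hc | hc
  · calc h ^ 2 * F ≤ (2 * K * t) ^ 2 * (2 * D) := by gcongr
      _ = (0 + 0 + 8 * D * K ^ 2) * t ^ 2 := by ring
      _ ≤ interiorConst D K K' * t ^ 2 := by
          unfold interiorConst
          gcongr <;> positivity
  have hδh : ∀ i, |δ i| ≤ h / 2 := fun i => (hδ i).trans (by linarith)
  have hpos : ∀ i, 0 < h + δ i := fun i => by linarith [(abs_le.1 (hδh i)).1]
  set M : ℝ := h ^ 2 * F with hM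
  have hM0 : 0 ≤ M := by positivity
  have hEi : ∀ i, h ^ 4 * (E i) ≤ M * (q i ^ 2 * (-2 * h * δ i + 16 * δ i ^ 2 + h ^ 2)) := by
    intro i
    have h1 : E i ≤ M * q i ^ 2 / (h + δ i) ^ 2 := by
      rw [le_div_iff₀ (pow_pos (hpos i) 2), mul_comm]
      exact hmax i (hpos i)
    have h2 := cutoff_ratio_le hh (hδh i)
    calc h ^ 4 * E i ≤ h ^ 4 * (M * q i ^ 2 / (h + δ i) ^ 2) := by gcongr
      _ = M * (q i ^ 2 * (h ^ 4 / (h + δ i) ^ 2)) := by ring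
      _ ≤ _ := by
        gcongr
        linarith
  -- Since `∑ q i ^ 2 = D`, the zeroth-order terms `M D h²` cancel.
  have hsum : M ^ 2 ≤ 4 * D ^ 2 * (M * ∑ i, q i ^ 2 * (-2 * h * δ i + 16 * δ i ^ 2)) := by
    calc M ^ 2 = h ^ 4 * F ^ 2 := by rw [hM]; ring
      _ ≤ h ^ 4 * (4 * D ^ 2 * ∑ i, (E i - F)) := by gcongr
      _ = 4 * D ^ 2 * (∑ i, h ^ 4 * E i - M * (D * h ^ 2)) := by
        rw [Finset.sum_sub_distrib, ← Finset.mul_sum]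
        simp only [Finset.sum_const, Finset.card_univ, nsmul_eq_mul, hM]
        ring
      _ ≤ 4 * D ^ 2 * (∑ i, M * (q i ^ 2 * (-2 * h * δ i + 16 * δ i ^ 2 + h ^ 2)) -
            M * (D * h ^ 2)) := by
        gcongr ?_ * (?_ - _)
        exact Finset.sum_le_sum fun i _ => hEi i
      _ = _ := by
        simp only [mul_add (q _ ^ 2) _ (h ^ 2), Finset.sum_add_distrib, ← Finset.mul_sum,
          ← Finset.sum_mul, hq2]
        ring
  have hC0 : 0 ≤ interiorConst D K K' * t ^ 2 := by
    unfold interiorConst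
    positivity
  rcases hM0.eq_or_lt with h0 | h0
  · exact h0 ▸ hC0
  have hM1 : M ≤ 4 * D ^ 2 * ∑ i, q i ^ 2 * (-2 * h * δ i + 16 * δ i ^ 2) := by
    refine le_of_mul_le_mul_left ?_ h0
    calc M * M = M ^ 2 := by ring
      _ ≤ _ := hsum
      _ = _ := by ring
  have hqD : ∀ i, q i ≤ D := by
    intro i
    have : q i ^ 2 ≤ D :=
      hq2 ▸ Finset.single_le_sum (f := fun i => q i ^ 2) (fun j _ => sq_nonneg _)
        (Finset.mem_univ i)
    nlinarith [hq i]
  have hqM : ∀ i, h * |q i - 1| ≤ √M := by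
    intro i
    refine Real.le_sqrt_of_sq_le ?_
    rw [mul_pow, sq_abs, hM]
    gcongr
    exact Finset.single_le_sum (f := fun i => (q i - 1) ^ 2) (fun j _ => sq_nonneg _)
      (Finset.mem_univ i)
  -- Write `q² = 1 + (q² - 1)` in the linear term: the first part sums to the Laplacian of the
  -- cutoff, the second is `O(t √M)` because `h |q - 1| ≤ √M`.
  have hterm : ∀ i, q i ^ 2 * (-2 * h * δ i + 16 * δ i ^ 2) ≤
      2 * h * -δ i + 2 * (D + 1) * K * t * √M + 16 * K ^ 2 * t ^ 2 * q i ^ 2 := by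
    intro i
    have h1 : (q i ^ 2 - 1) * (-2 * h * δ i) ≤ 2 * (D + 1) * K * t * √M := by
      calc (q i ^ 2 - 1) * (-2 * h * δ i) ≤ |(q i ^ 2 - 1) * (-2 * h * δ i)| := le_abs_self _
        _ = 2 * (q i + 1) * |δ i| * (h * |q i - 1|) := by
          rw [show (q i ^ 2 - 1) * (-2 * h * δ i) = -(2 * (q i + 1) * (δ i * (h * (q i - 1)))) by
            ring, abs_neg, abs_mul, abs_mul (δ i), abs_mul h, abs_of_pos hh,
            abs_of_pos (show 0 < 2 * (q i + 1) by linarith [hq i])]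
          ring
        _ ≤ 2 * (D + 1) * (K * t) * √M := by
          have := hq i
          gcongr
          · exact hqD i
          · exact hδ i
          · exact hqM i
        _ = _ := by ring
    have h2 : δ i ^ 2 ≤ K ^ 2 * t ^ 2 := by
      rw [← mul_pow, ← sq_abs]
      gcongr
      exact hδ i
    nlinarith [mul_le_mul_of_nonneg_left h2 (sq_nonneg (q i))]
  have hM2 : M ≤ 4 * D ^ 2 * (2 * K' * t ^ 2 + D * (2 * (D + 1) * K * t * √M) +
      16 * K ^ 2 * t ^ 2 * D) := by
    refine hM1.trans ?_
    gcongr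
    refine (Finset.sum_le_sum fun i _ => hterm i).trans ?_
    rw [Finset.sum_add_distrib, Finset.sum_add_distrib, ← Finset.mul_sum, ← Finset.mul_sum _ (fun i => q i ^ 2), hq2,
      Finset.sum_neg_distrib]
    simp only [Finset.sum_const, Finset.card_univ, nsmul_eq_mul]
    gcongr ?_ + _ + _
    calc 2 * h * -∑ i, δ i ≤ 2 * h * (K' * t ^ 2) := by gcongr
      _ ≤ 2 * 1 * (K' * t ^ 2) := by gcongr
      _ = _ := by ring
  -- A quadratic inequality for `√M / t`, hence `M = O(t²)`.
  have hm : (√M / t) ^ 2 ≤ 4 * D ^ 2 * (2 * K' + 16 * D * K ^ 2) +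
      4 * D ^ 2 * (2 * D * (D + 1) * K) * (√M / t) := by
    rw [div_pow, Real.sq_sqrt hM0, div_le_iff₀ (by positivity)]
    refine hM2.trans (le_of_eq ?_)
    field_simp
    ring
  have := sq_le_of_sq_le_add hm
  rw [div_pow, Real.sq_sqrt hM0, div_le_iff₀ (by positivity)] at this
  refine this.trans (mul_le_mul_of_nonneg_right ?_ (sq_nonneg t))
  exact le_add_of_nonneg_right (by positivity)

/-! ### Interior estimate for the square root. -/

section Interior

variable {G : Type*} [AddCommGroup G] {ι : Type*} [Fintype ι]

/-- The energy density of `u` at `x` with respect to the steps `e i`. -/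
def energy (e : ι → G) (u : G → ℝ) (x : G) : ℝ :=
  ∑ i, (u (x + e i) - u x) ^ 2

theorem energy_sqrt_sq_le [Nonempty ι] {e : ι → G} {ν : ι → ι} (hν : ∀ i, e (ν i) = -e i)
    (hsum : ∀ g : G → ℝ, ∑ i, g (-e i) = ∑ i, g (e i)) {f : G → ℝ} {x : G} (hf : 0 < f x)
    (hf₁ : ∀ i, 0 < f (x + e i)) (hf₂ : ∀ i j, 0 < f (x + e i + e j))
    (h₁ : ∑ i, f (x + e i) = Fintype.card ι * f x)
    (h₂ : ∀ i, ∑ j, f (x + e i + e j) = Fintype.card ι * f (x + e i)) :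
    energy e (fun y => √(f y)) x ^ 2 ≤ 4 * (Fintype.card ι : ℝ) ^ 2 * f x *
      ∑ i, (energy e (fun y => √(f y)) (x + e i) - energy e (fun y => √(f y)) x) := by
  have := bochner_inequality (a := √(f x)) (Real.sqrt_pos.2 hf) (α := fun i => √(f (x + e i)))
    (fun i => Real.sqrt_pos.2 (hf₁ i)) (β := fun i j => √(f (x + e i + e j)))
    (fun i j => by rw [add_right_comm])
    (by simpa only [Real.sq_sqrt hf.le, Real.sq_sqrt (hf₁ _).le] using h₁)
    (fun i => by simpa only [Real.sq_sqrt (hf₂ _ _).le, Real.sq_sqrt (hf₁ _).le] using h₂ i)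
    ν (fun i => by rw [hν, add_neg_cancel_right])
    (by simpa only [hν] using hsum fun g => √(f (x + g)))
  simpa only [Real.sq_sqrt hf.le, energy] using this

/-- The interior gradient estimate for the square root of a positive harmonic function, for the
cutoff function `(1 - t² ‖π (y - x)‖²)²`. -/
theorem energy_sqrt_le [Nonempty ι] {e : ι → G} {ν : ι → ι} (hν : ∀ i, e (ν i) = -e i)
    (hsum : ∀ g : G → ℝ, ∑ i, g (-e i) = ∑ i, g (e i)) {E : Type*} [NormedAddCommGroup E]
    [InnerProductSpace ℝ E] (π : G →+ E) {t : ℝ} (ht : 0 < t) (ht1 : t ≤ 1) {x : G}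
    (hfin : {y : G | ‖π (y - x)‖ * t < 1}.Finite) {f : G → ℝ} {Ω : Set G}
    (hΩ : ∀ y, ‖π (y - x)‖ * t < 1 → y ∈ Ω ∧ ∀ i, y + e i ∈ Ω ∧ ∀ j, y + e i + e j ∈ Ω)
    (hf : ∀ y ∈ Ω, 0 < f y) (hharm : ∀ y ∈ Ω, ∑ i, f (y + e i) = Fintype.card ι * f y) :
    energy e (fun y => √(f y)) x ≤ interiorConst (Fintype.card ι)
      (∑ i, (2 * ‖π (e i)‖ + ‖π (e i)‖ ^ 2)) (∑ i, ‖π (e i)‖ ^ 2) * t ^ 2 * f x := by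
  set u : G → ℝ := fun y => √(f y) with hu
  set h : G → ℝ := fun y => 1 - t ^ 2 * ‖π (y - x)‖ ^ 2 with hh
  have hpos : ∀ y, 0 < h y ↔ ‖π (y - x)‖ * t < 1 := by
    intro y
    rw [hh, sub_pos, ← mul_pow, mul_comm, pow_lt_one_iff_of_nonneg (by positivity) two_ne_zero]
  have hx : ‖π (x - x)‖ * t < 1 := by simp
  obtain ⟨z, hz, hzmax⟩ := Set.exists_max_image _ (fun y => h y ^ 2 * (energy e u y / f y)) hfin
    ⟨x, hx⟩
  have hhx : h x = 1 := by simp [hh]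
  obtain ⟨hzΩ, hzi⟩ := hΩ z hz
  have hfx := hf x (hΩ x hx).1
  have hfz := hf z hzΩ
  have hfi : ∀ i, 0 < f (z + e i) := fun i => hf _ (hzi i).1
  have huz : 0 < u z := Real.sqrt_pos.2 hfz
  have hui : ∀ i, 0 < u (z + e i) := fun i => Real.sqrt_pos.2 (hfi i)
  have husq : u z ^ 2 = f z := Real.sq_sqrt hfz.le
  have huisq : ∀ i, u (z + e i) ^ 2 = f (z + e i) := fun i => Real.sq_sqrt (hfi i).le
  have hF : ∑ j, (u (z + e j) / u z - 1) ^ 2 = energy e u z / f z := by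
    rw [energy, Finset.sum_div, ← husq]
    refine Finset.sum_congr rfl fun i _ => ?_
    field_simp
  set w := π (z - x) with hw
  have hδ : ∀ i, h (z + e i) - h z = -(t ^ 2 * (2 * inner ℝ w (π (e i)) + ‖π (e i)‖ ^ 2)) := by
    intro i
    simp only [hh]
    rw [add_sub_right_comm, map_add, norm_add_sq_real]
    ring
  have hmain := cutoff_energy_le_of_max (q := fun i => u (z + e i) / u z)
    (δ := fun i => h (z + e i) - h z) (E := fun i => energy e u (z + e i) / f z) (h := h z) (t := t)
    (K := ∑ i, (2 * ‖π (e i)‖ + ‖π (e i)‖ ^ 2)) (K' := ∑ i, ‖π (e i)‖ ^ 2)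
    (fun i => div_pos (hui i) huz) ?_ ((hpos z).2 hz) ?_ ht (by positivity) ?_ ?_ ?_ ?_
  · have := hzmax x hx
    simp only [hhx, one_pow, one_mul] at this
    rw [hF] at hmain
    exact (div_le_iff₀ hfx).1 (this.trans hmain)
  · simp only [div_pow, husq, huisq]
    rw [← Finset.sum_div, hharm z hzΩ]
    field_simp
  · simp only [hh, sub_le_self_iff]
    positivity
  · intro i
    have h1 := abs_real_inner_le_norm w (π (e i))
    have h2 : |2 * inner ℝ w (π (e i)) + ‖π (e i)‖ ^ 2| ≤
        2 * (‖w‖ * ‖π (e i)‖) + ‖π (e i)‖ ^ 2 := by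
      refine (abs_add_le _ _).trans ?_
      rw [abs_mul, abs_two, abs_of_nonneg (sq_nonneg ‖π (e i)‖)]
      gcongr
    have h3 : 2 * ‖π (e i)‖ + ‖π (e i)‖ ^ 2 ≤ ∑ i, (2 * ‖π (e i)‖ + ‖π (e i)‖ ^ 2) :=
      Finset.single_le_sum (f := fun i => 2 * ‖π (e i)‖ + ‖π (e i)‖ ^ 2)
        (fun j _ => by positivity) (Finset.mem_univ i)
    rw [hδ, abs_neg, abs_mul, abs_of_pos (by positivity)]
    calc t ^ 2 * |2 * inner ℝ w (π (e i)) + ‖π (e i)‖ ^ 2|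
        ≤ t ^ 2 * (2 * (‖w‖ * ‖π (e i)‖) + ‖π (e i)‖ ^ 2) := by gcongr
      _ = (2 * ((‖w‖ * t) * ‖π (e i)‖) + t * ‖π (e i)‖ ^ 2) * t := by ring
      _ ≤ (2 * (1 * ‖π (e i)‖) + 1 * ‖π (e i)‖ ^ 2) * t := by
        gcongr
        exact le_of_lt hz
      _ ≤ _ := by
        gcongr
        simpa using h3
  -- The symmetry of the steps cancels the first-order part of the cutoff.
  · have hin : ∑ i, inner ℝ w (π (e i)) = 0 := by
      have := hsum fun g => inner ℝ w (π g)
      simp only [map_neg, inner_neg_right, Finset.sum_neg_distrib] at this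
      linarith
    simp only [hδ, Finset.sum_neg_distrib, neg_neg, ← Finset.mul_sum, Finset.sum_add_distrib, hin]
    exact le_of_eq (by ring)
  · intro i hi
    simp only [add_sub_cancel] at hi ⊢
    have := hzmax _ ((hpos _).1 hi)
    rw [hF]
    simp only [div_pow, husq, huisq]
    have h1 := mul_le_mul_of_nonneg_right this (div_pos (hfi i) hfz).le
    refine le_trans (le_of_eq ?_) h1
    have := (hfi i).ne'
    field_simp
  · rw [hF]
    have := energy_sqrt_sq_le hν hsum hfz hfi (fun i j => hf _ ((hzi i).2 j)) (hharm z hzΩ)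
      (fun i => hharm _ (hzi i).1)
    rw [← hu] at this
    rw [div_pow, div_le_iff₀ (by positivity)]
    refine this.trans (le_of_eq ?_)
    simp only [← sub_div, ← Finset.sum_div]
    field_simp

end Interior

/-! ### From the square root back to the function. -/

theorem interiorConst_nonneg {D K K' : ℝ} (hD : 0 ≤ D) (hK' : 0 ≤ K') :
    0 ≤ interiorConst D K K' := by
  unfold interiorConst
  positivity

/-- Factor `f(x+e) - f(x)` as a difference of squares of roots; positivity and harmonicity give
`f(x+e) ≤ D f(x)`, which bounds the factor with the plus sign. -/
theorem sum_sq_sub_le_energy_sqrt {G : Type*} [AddCommGroup G] {ι : Type*} [Fintype ι]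
    [Nonempty ι] {e : ι → G} {f : G → ℝ} {x : G} (hf : 0 < f x) (hf₁ : ∀ i, 0 < f (x + e i))
    (h₁ : ∑ i, f (x + e i) = Fintype.card ι * f x) :
    ∑ i, (f (x + e i) - f x) ^ 2 ≤
      ((Fintype.card ι : ℝ) + 1) ^ 2 * f x * energy e (fun y => √(f y)) x := by
  have hD : (1 : ℝ) ≤ Fintype.card ι := by exact_mod_cast Fintype.card_pos (α := ι)
  rw [energy, Finset.mul_sum]
  refine Finset.sum_le_sum fun i _ => ?_
  have h2 : f (x + e i) ≤ Fintype.card ι * f x :=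
    h₁ ▸ Finset.single_le_sum (f := fun i => f (x + e i)) (fun j _ => (hf₁ j).le)
      (Finset.mem_univ i)
  have h3 : √(f (x + e i)) ≤ Fintype.card ι * √(f x) := by
    refine Real.sqrt_le_iff.2 ⟨by positivity, ?_⟩
    rw [mul_pow, Real.sq_sqrt hf.le]
    refine h2.trans (mul_le_mul_of_nonneg_right ?_ hf.le)
    nlinarith
  calc (f (x + e i) - f x) ^ 2
      = (√(f (x + e i)) + √(f x)) ^ 2 * (√(f (x + e i)) - √(f x)) ^ 2 := by
        rw [← mul_pow, ← sq_sub_sq, Real.sq_sqrt hf.le, Real.sq_sqrt (hf₁ i).le]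
    _ ≤ (Fintype.card ι * √(f x) + √(f x)) ^ 2 * (√(f (x + e i)) - √(f x)) ^ 2 := by gcongr
    _ = _ := by
        rw [← add_one_mul, mul_pow, Real.sq_sqrt hf.le]

theorem finite_of_wordLength_le {G : Type*} [AddCommGroup G] {S : Multiset G}
    (hsymm : S.map (fun s => -s) = S) (hgen : AddSubgroup.closure {s : G | s ∈ S} = ⊤) {x : G}
    {p : G → Prop} {c : ℝ} (h : ∀ y, p y → (wordLength S (y - x) : ℝ) ≤ c) :
    {y : G | p y}.Finite := by
  refine ((finite_wordLength_le hsymm hgen ⌊c⌋₊).preimage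
    (sub_left_injective (b := x)).injOn).subset fun y hy => ?_
  exact Nat.le_floor (h y hy)

end AbelianCayley

open AbelianCayley in
theorem theorem1p1 {G : Type*} [AddCommGroup G] (S : Multiset G)
    (hsymm : S.map (fun s => -s) = S)
    (hgen : AddSubgroup.closure {s : G | s ∈ S} = ⊤) :
    ∃ C₁ C₂ : ℝ, 0 < C₁ ∧ 0 < C₂ ∧
      ∀ (x : G) (R : ℝ), 1 ≤ R → ∀ f : G → ℝ,
        (∀ y ∈ AbelianCayley.ball S x (C₁ * R), 0 < f y) →
        AbelianCayley.HarmonicOn S f (AbelianCayley.ball S x (C₁ * R)) →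
        AbelianCayley.gradNorm S f x ≤ C₂ / R * f x := by
  classical
  rcases S.empty_or_exists_mem with rfl | ⟨s₀, hs₀⟩
  · refine ⟨1, 1, one_pos, one_pos, fun x R hR f hf _ => ?_⟩
    have := hf x (mem_ball_of_wordLength_le hsymm hgen (by
      rw [sub_self, wordLength_zero, Nat.cast_zero]
      positivity))
    simp only [gradNorm, Multiset.map_zero, Multiset.sum_zero, Real.sqrt_zero]
    positivity
  have : Nonempty S := ⟨S.mkToType s₀ ⟨0, Multiset.count_pos.2 hs₀⟩⟩
  -- The index type is the multiset coerced to a type, so repeated generators are distinct indices.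
  let e : S → G := fun i => i
  have he : ∀ i, e i ∈ S := fun i => Multiset.coe_mem
  have hmap : ∀ g : G → ℝ, (S.map g).sum = ∑ i, g (e i) := fun g => by
    rw [← Multiset.map_univ S g]
    rfl
  have hsum : ∀ g : G → ℝ, ∑ i, g (-e i) = ∑ i, g (e i) := fun g => by
    rw [← hmap g, ← hmap fun s => g (-s)]
    conv_rhs => rw [← hsymm, Multiset.map_map]
    rfl
  have hν : ∀ i, ∃ j, e j = -e i := fun i =>
    ⟨S.mkToType (-e i) ⟨0, Multiset.count_pos.2 (neg_mem_of_symm hsymm (he i))⟩, rfl⟩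
  choose ν hν using hν
  obtain ⟨n, π, C, hC, hπ⟩ := exists_hom_wordLength_le hsymm hgen
  set B := interiorConst (Fintype.card S) (∑ i, (2 * ‖π (e i)‖ + ‖π (e i)‖ ^ 2))
    (∑ i, ‖π (e i)‖ ^ 2) with hB
  have hB0 : 0 ≤ B := interiorConst_nonneg (by positivity) (by positivity)
  -- `2 C R` bounds the word length where the cutoff is positive, using `1 ≤ R`; the extra `2`
  -- leaves room for two more steps. `B + 1` replaces `√B` and keeps the constant positive.
  refine ⟨2 * C + 2, (Fintype.card S + 1) * (B + 1), by positivity, by positivity,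
    fun x R hR f hf hharm => ?_⟩
  have hR0 : 0 < R := one_pos.trans_le hR
  have hlen : ∀ y, ‖π (y - x)‖ * R⁻¹ < 1 → (wordLength S (y - x) : ℝ) ≤ 2 * C * R := by
    intro y hy
    rw [← div_eq_mul_inv, div_lt_one hR0] at hy
    calc (wordLength S (y - x) : ℝ) ≤ C * (‖π (y - x)‖ + 1) := hπ _
      _ ≤ C * (R + R) := by gcongr
      _ = _ := by ring
  have hstep : ∀ y i, (wordLength S (y + e i - x) : ℝ) ≤ wordLength S (y - x) + 1 := by
    intro y i
    rw [add_sub_right_comm]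
    exact_mod_cast (wordLength_add_le hsymm hgen _ _).trans
      (Nat.add_le_add_left (wordLength_le_one (he i)) _)
  have hΩ : ∀ y, ‖π (y - x)‖ * R⁻¹ < 1 → y ∈ ball S x ((2 * C + 2) * R) ∧
      ∀ i, y + e i ∈ ball S x ((2 * C + 2) * R) ∧
        ∀ j, y + e i + e j ∈ ball S x ((2 * C + 2) * R) := by
    intro y hy
    have := hlen y hy
    exact ⟨mem_ball_of_wordLength_le hsymm hgen (by linarith), fun i =>
      ⟨mem_ball_of_wordLength_le hsymm hgen (by linarith [hstep y i]), fun j =>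
        mem_ball_of_wordLength_le hsymm hgen (by linarith [hstep y i, hstep (y + e i) j])⟩⟩
  have hharm' : ∀ y ∈ ball S x ((2 * C + 2) * R),
      ∑ i, f (y + e i) = Fintype.card S * f y := by
    intro y hy
    have := hharm y hy
    rw [laplacian, hmap, Finset.sum_sub_distrib] at this
    simpa [sub_eq_zero] using this
  have hmain := energy_sqrt_le hν hsum π (inv_pos.2 hR0) (inv_le_one_of_one_le₀ hR)
    (finite_of_wordLength_le hsymm hgen hlen) hΩ hf hharm'
  obtain ⟨hx, hxi⟩ := hΩ x (by simp)
  have hfx := hf x hx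
  have hgrad := sum_sq_sub_le_energy_sqrt hfx (fun i => hf _ (hxi i).1) (hharm' x hx)
  rw [gradNorm, hmap]
  refine Real.sqrt_le_iff.2 ⟨by positivity, hgrad.trans ?_⟩
  rw [← hB] at hmain
  calc ((Fintype.card S : ℝ) + 1) ^ 2 * f x * energy e (fun y => √(f y)) x
      ≤ ((Fintype.card S : ℝ) + 1) ^ 2 * f x * (B * R⁻¹ ^ 2 * f x) := by gcongr
    _ ≤ ((Fintype.card S : ℝ) + 1) ^ 2 * f x * ((B + 1) ^ 2 * R⁻¹ ^ 2 * f x) := by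
      gcongr
      nlinarith
    _ = _ := by
      rw [div_eq_mul_inv]
      ring
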